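/- Let $D\subset\mathbb{C}$ be a bounded domain with $C^1$ boundary, let $u\ge 0$ be a real function that is $C^\infty$ in a neighborhood of $\overline D$, and let $f:\partial D\to\mathbb{R}$ be a bounded Borel function. For $z\in D$ let $g_z$ be the Green function of the Laplacian on $D$ with singularity at $z$, that is, $\Delta g_z=\delta_z$ in $D$ (in the sense of distributions), with $g_z$ continuous on $\overline D\setminus\{z\}$ and $g_z=0$ on $\partial D$. Let $\phi_0$ be the Perron solution of the Dirichlet problem $\Delta\phi_0=0$ in $D$, $\phi_0=f$ on $\partial D$, that is, $\phi_0(\xi)=\sup_v v(\xi)$ over all continuous subharmonic functions $v$ on $D$ with $\limsup_{\xi\to\zeta}v(\xi)\le f(\zeta)$ for every $\zeta\in\partial D$. For the solution $\phi_\epsilon$ of $(\Delta-\epsilon u)\phi_\epsilon=0$ in $D$, $\phi_\epsilon=f$ on $\partial D$, the linearization (the coefficient of $\epsilon$ in the expansion of $\phi_\epsilon$ as $\epsilon\to0$) is $$\delta\phi_\epsilon(z)=\int_D u\,\phi_0\,g_z\,dA ,$$ and this formula is taken here as the definition of $\delta\phi_\epsilon(z)$. Then, for every $z\in D$, $u$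 and $g_z$ belong to $L^2(D)$, the integral converges absolutely, and $$|\delta\phi_\epsilon(z)|\le \|u\|_2\,\|g_z\|_2\,\|f\|_\infty ,$$ where $\|\cdot\|_2$ is the norm of $L^2(D,dA)$ and $\|f\|_\infty=\sup_{\partial D}|f|$. -/

import Mathlib

open MeasureTheory Set Filter Topology
open scoped ContDiff Laplacian

/-- A bounded planar domain with `C¹` boundary: a nonempty, connected, bounded open set which near
each of its boundary points is the sublevel set `{ρ < 0}` of a `C¹` function `ρ` whose
differential does not vanish at that point. -/
structure IsBoundedC1Domain (D : Set ℂ) : Prop where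
  isOpen : IsOpen D
  isConnected : IsConnected D
  isBounded : Bornology.IsBounded D
  c1_boundary : ∀ ζ ∈ frontier D, ∃ ρ : ℂ → ℝ, ContDiffAt ℝ 1 ρ ζ ∧ fderiv ℝ ρ ζ ≠ 0 ∧
    ∀ᶠ ξ in 𝓝 ζ, (ξ ∈ D ↔ ρ ξ < 0)

/-- `u ∈ C^∞(closure D)`: `u` is smooth in a neighborhood of the closure of `D`. -/
def IsSmoothOnClosure (D : Set ℂ) (u : ℂ → ℝ) : Prop :=
  ∃ U : Set ℂ, IsOpen U ∧ closure D ⊆ U ∧ ContDiffOn ℝ ∞ u U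

/-- `g` is the Green function of the Laplacian on `D` with singularity at `w`: it solves
`Δ g = δ_w` in `D` in the sense of distributions, is continuous up to the boundary away from `w`,
and vanishes on the boundary. -/
structure IsGreenFunction (D : Set ℂ) (w : ℂ) (g : ℂ → ℝ) : Prop where
  continuousOn : ContinuousOn g (closure D \ {w})
  locallyIntegrable : LocallyIntegrableOn g D
  laplacian_eq : ∀ ψ : ℂ → ℝ, ContDiff ℝ ∞ ψ → HasCompactSupport ψ → tsupport ψ ⊆ D →
    ∫ ξ in D, g ξ * (Δ ψ) ξ = ψ w
  boundary : ∀ ζ ∈ frontier D, g ζ = 0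

/-- A continuous function `v` is subharmonic on the open set `D` if its value at the center of any
closed disk contained in `D` is at most its average over the bounding circle. -/
structure IsSubharmonicOn (D : Set ℂ) (v : ℂ → ℝ) : Prop where
  continuousOn : ContinuousOn v D
  le_circleAverage : ∀ c : ℂ, ∀ r : ℝ, 0 < r → Metric.closedBall c r ⊆ D →
    v c ≤ Real.circleAverage v c r

/-- The Perron class of the boundary function `f`: the subharmonic functions `v` on `D` with
`limsup_{ξ → ζ} v ξ ≤ f ζ` at every boundary point `ζ`. -/
structure IsPerronSubfunction (D : Set ℂ) (f : frontier D → ℝ) (v : ℂ → ℝ) : Prop where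
  subharmonic : IsSubharmonicOn D v
  limsup_le : ∀ ζ : frontier D, ∀ b : ℝ, f ζ < b → ∀ᶠ ξ in 𝓝[D] (ζ : ℂ), v ξ < b

/-- The (generalized, Perron) solution `φ₀` of the Dirichlet problem `Δ φ₀ = 0` in `D`, `φ₀ = f`
on the boundary: the upper envelope of the Perron class of `f`. For bounded Borel `f` it is the
Poisson integral of `f`, that is, the integral of `f` against harmonic measure. -/
noncomputable def dirichletSolution (D : Set ℂ) (f : frontier D → ℝ) (ξ : ℂ) : ℝ :=
  sSup {t : ℝ | ∃ v : ℂ → ℝ, IsPerronSubfunction D f v ∧ v ξ = t}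

/-- The coefficient of `ε` in the expansion of the solution `φ_ε` of `(Δ - ε u) φ_ε = 0` in `D`,
`φ_ε = f` on the boundary, at the point at which the Green function `g` has its singularity. -/
noncomputable def firstOrderTerm (D : Set ℂ) (u : ℂ → ℝ) (f : frontier D → ℝ) (g : ℂ → ℝ) : ℝ :=
  ∫ ξ in D, u ξ * dirichletSolution D f ξ * g ξ

/-- The norm of `L²(D)` with respect to area measure. -/
noncomputable def l2Norm (D : Set ℂ) (h : ℂ → ℝ) : ℝ := lpNorm h 2 (volume.restrict D)

/-- The sup norm of a bounded function on the boundary of `D`. -/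
noncomputable def boundarySupNorm (D : Set ℂ) (f : frontier D → ℝ) : ℝ := ⨆ ζ, |f ζ|

/-- The maximum principle for continuous subharmonic functions on a bounded open set. -/
theorem IsSubharmonicOn.le_of_boundary {D : Set ℂ} (hD : IsOpen D) (hb : Bornology.IsBounded D)
    {v : ℂ → ℝ} (hv : IsSubharmonicOn D v) {M : ℝ}
    (hM : ∀ ζ ∈ frontier D, ∀ b, M < b → ∀ᶠ ξ in 𝓝[D] ζ, v ξ < b) {x : ℂ} (hx : x ∈ D) :
    v x ≤ M := by
  by_contra! h
  obtain ⟨b, hMb, hbx⟩ := exists_between h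
  have key : ∀ S : Set ℝ, IsClosed S → S ⊆ Ici b → IsCompact (D ∩ v ⁻¹' S) := by
    intro S hS hSb
    refine Metric.isCompact_of_isClosed_isBounded ?_ (hb.subset inter_subset_left)
    refine isClosed_of_closure_subset fun y hy => ?_
    have hyD : y ∈ D := by
      by_contra hyD
      have hyf : y ∈ frontier D := by
        rw [frontier, hD.interior_eq]
        exact ⟨closure_mono inter_subset_left hy, hyD⟩
      have hev := eventually_nhdsWithin_iff.1 (hM y hyf b hMb)
      obtain ⟨p, ⟨hpD, hpS⟩, hp⟩ := ((mem_closure_iff_frequently.1 hy).and_eventually hev).exists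
      exact absurd (hp hpD) (not_lt.2 (hSb hpS))
    refine ⟨hyD, ?_⟩
    have hc : ContinuousWithinAt v (D ∩ v ⁻¹' S) y :=
      (hv.continuousOn y hyD).mono inter_subset_left
    have := hc.mem_closure_image hy
    exact hS.closure_subset_iff.2 (image_subset_iff.2 inter_subset_right) this
  obtain ⟨p, ⟨hpD, hpb⟩, hpmax⟩ := (key (Ici b) isClosed_Ici subset_rfl).exists_isMaxOn
    ⟨x, hx, hbx.le⟩ (hv.continuousOn.mono inter_subset_left)
  have hle : ∀ y ∈ D, v y ≤ v p := by
    intro y hy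
    by_cases hyb : b ≤ v y
    · exact hpmax ⟨hy, hyb⟩
    · exact (not_le.1 hyb).le.trans hpb
  obtain ⟨q, ⟨hqD, hqv⟩, hqmax⟩ := (key {v p} isClosed_singleton
    (singleton_subset_iff.2 hpb)).exists_isMaxOn ⟨p, hpD, rfl⟩ Complex.continuous_re.continuousOn
  obtain ⟨r, hr, hrD⟩ := Metric.nhds_basis_closedBall.mem_iff.1 (hD.mem_nhds hqD)
  have hav := hv.le_circleAverage q r hr hrD
  have hmem : ∀ θ, circleMap q r θ ∈ D := fun θ =>
    hrD (Metric.sphere_subset_closedBall (circleMap_mem_sphere q hr.le θ))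
  have hlt : (∫ θ in (0 : ℝ)..2 * Real.pi, v (circleMap q r θ)) <
      ∫ _ in (0 : ℝ)..2 * Real.pi, v p := by
    refine intervalIntegral.integral_lt_integral_of_continuousOn_of_le_of_exists_lt
      Real.two_pi_pos ?_ continuousOn_const (fun θ _ => hle _ (hmem θ))
      ⟨0, ⟨le_rfl, Real.two_pi_pos.le⟩, ?_⟩
    · exact hv.continuousOn.comp (continuous_circleMap q r).continuousOn fun θ _ => hmem θ
    · refine lt_of_le_of_ne (hle _ (hmem 0)) fun heq => ?_
      have := hqmax (a := circleMap q r 0) ⟨hmem 0, heq⟩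
      simp [circleMap] at this
      linarith
  rw [Real.circleAverage_def, hqv, smul_eq_mul] at hav
  rw [intervalIntegral.integral_const, smul_eq_mul, sub_zero] at hlt
  have h2 := mul_lt_mul_of_pos_left hlt (inv_pos.2 Real.two_pi_pos)
  rw [inv_mul_cancel_left₀ Real.two_pi_pos.ne'] at h2
  linarith

theorem isPerronSubfunction_const {D : Set ℂ} {f : frontier D → ℝ} {m : ℝ} (hm : ∀ ζ, m ≤ f ζ) :
    IsPerronSubfunction D f fun _ => m where
  subharmonic := ⟨continuousOn_const, fun c r _ _ => (Real.circleAverage_const m c r).ge⟩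
  limsup_le ζ _ hb := .of_forall fun _ => (hm ζ).trans_lt hb

theorem IsPerronSubfunction.le {D : Set ℂ} (hD : IsOpen D) (hb : Bornology.IsBounded D)
    {f : frontier D → ℝ} {v : ℂ → ℝ} (hv : IsPerronSubfunction D f v) {M : ℝ}
    (hM : ∀ ζ, f ζ ≤ M) {x : ℂ} (hx : x ∈ D) : v x ≤ M :=
  hv.subharmonic.le_of_boundary hD hb
    (fun ζ hζ b hMb => hv.limsup_le ⟨ζ, hζ⟩ b ((hM _).trans_lt hMb)) hx

theorem abs_dirichletSolution_le {D : Set ℂ} (hD : IsOpen D) (hb : Bornology.IsBounded D)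
    {f : frontier D → ℝ} {M : ℝ} (hM : ∀ ζ, |f ζ| ≤ M) {x : ℂ} (hx : x ∈ D) :
    |dirichletSolution D f x| ≤ M := by
  have hmem : -M ∈ {t : ℝ | ∃ v : ℂ → ℝ, IsPerronSubfunction D f v ∧ v x = t} :=
    ⟨_, isPerronSubfunction_const fun ζ => (abs_le.1 (hM ζ)).1, rfl⟩
  have hub : ∀ t ∈ {t : ℝ | ∃ v : ℂ → ℝ, IsPerronSubfunction D f v ∧ v x = t}, t ≤ M := by
    rintro _ ⟨v, hv, rfl⟩
    exact hv.le hD hb (fun ζ => (abs_le.1 (hM ζ)).2) hx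
  exact abs_le.2 ⟨le_csSup ⟨M, hub⟩ hmem, csSup_le ⟨_, hmem⟩ hub⟩

theorem lowerSemicontinuous_dirichletSolution {D : Set ℂ} (hD : IsOpen D)
    (hb : Bornology.IsBounded D) {f : frontier D → ℝ} {M : ℝ} (hM : ∀ ζ, |f ζ| ≤ M) :
    LowerSemicontinuous fun x : D => dirichletSolution D f x := by
  intro x y hy
  have hne : {t : ℝ | ∃ v : ℂ → ℝ, IsPerronSubfunction D f v ∧ v x = t}.Nonempty :=
    ⟨-M, _, isPerronSubfunction_const fun ζ => (abs_le.1 (hM ζ)).1, rfl⟩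
  obtain ⟨_, ⟨v, hv, rfl⟩, hlt⟩ := exists_lt_of_lt_csSup hne hy
  have hc : Continuous fun x : D => v x := continuousOn_iff_continuous_domRestrict.1
    hv.subharmonic.continuousOn
  filter_upwards [hc.continuousAt.eventually (lt_mem_nhds hlt)] with x' hx'
  refine hx'.trans_le (le_csSup ⟨M, ?_⟩ ⟨v, hv, rfl⟩)
  rintro _ ⟨w, hw, rfl⟩
  exact hw.le hD hb (fun ζ => (abs_le.1 (hM ζ)).2) x'.2

theorem aestronglyMeasurable_dirichletSolution {D : Set ℂ} (hD : IsOpen D)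
    (hb : Bornology.IsBounded D) {f : frontier D → ℝ} {M : ℝ} (hM : ∀ ζ, |f ζ| ≤ M) :
    AEStronglyMeasurable (dirichletSolution D f) (volume.restrict D) :=
  (aemeasurable_restrict_of_measurable_subtype hD.measurableSet
    (lowerSemicontinuous_dirichletSolution hD hb hM).measurable).aestronglyMeasurable

theorem memLp_restrict_of_continuousOn_isCompact {D : Set ℂ} (hb : Bornology.IsBounded D)
    (hm : MeasurableSet D) {h : ℂ → ℝ} {K : Set ℂ} (hK : IsCompact K) (hDK : D ⊆ K)
    (hh : ContinuousOn h K) {p : ENNReal} : MemLp h p (volume.restrict D) := by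
  obtain ⟨C, hC⟩ := hK.exists_bound_of_continuousOn hh
  have : IsFiniteMeasure (volume.restrict D) :=
    isFiniteMeasure_restrict.2 (hb.measure_lt_top (μ := volume)).ne
  exact MemLp.of_bound ((hh.mono hDK).aestronglyMeasurable hm) C
    (ae_restrict_of_forall_mem hm fun x hx => hC x (hDK hx))

/-- Hölder's inequality for a product with a bounded middle factor. -/
theorem integrable_and_abs_integral_mul_mul_le {α : Type*} [MeasurableSpace α] {μ : Measure α}
    {u φ g : α → ℝ} (hu : MemLp u 2 μ) (hg : MemLp g 2 μ) (hφ : AEStronglyMeasurable φ μ) {M : ℝ}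
    (hM : ∀ᵐ x ∂μ, |φ x| ≤ M) :
    Integrable (fun x => u x * φ x * g x) μ ∧
      |∫ x, u x * φ x * g x ∂μ| ≤ lpNorm u 2 μ * lpNorm g 2 μ * M := by
  have hug : Integrable (fun x => u x * g x) μ := hu.integrable_mul hg
  have hint : Integrable (fun x => u x * φ x * g x) μ := by
    refine (hug.bdd_mul hφ hM).congr (.of_forall fun x => ?_)
    simp only
    ring
  refine ⟨hint, ?_⟩
  have hsq : ∀ {h : α → ℝ}, MemLp h 2 μ → lpNorm h 2 μ = (∫ x, |h x| ^ (2 : ℝ) ∂μ) ^ (1 / 2 : ℝ) := by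
    intro h hh
    rw [lpNorm_eq_integral_norm_rpow_toReal two_ne_zero ENNReal.ofNat_ne_top hh.1]
    simp
  calc |∫ x, u x * φ x * g x ∂μ| ≤ ∫ x, |u x * φ x * g x| ∂μ := abs_integral_le_integral_abs
    _ ≤ ∫ x, |u x| * |g x| * M ∂μ := by
      refine integral_mono_ae hint.abs ?_ ?_
      · simpa only [abs_mul] using hug.abs.mul_const M
      · filter_upwards [hM] with x hx
        rw [abs_mul, abs_mul, mul_right_comm]
        gcongr
    _ = (∫ x, |u x| * |g x| ∂μ) * M := integral_mul_const _ _
    _ ≤ lpNorm u 2 μ * lpNorm g 2 μ * M := by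
      rcases eq_or_ne μ 0 with rfl | hμ
      · simp
      have hM0 : 0 ≤ M := by
        have : (ae μ).NeBot := ae_neBot.2 hμ
        obtain ⟨x, hx⟩ := hM.exists
        exact (abs_nonneg _).trans hx
      refine mul_le_mul_of_nonneg_right ?_ hM0
      rw [hsq hu, hsq hg]
      refine integral_mul_le_Lp_mul_Lq_of_nonneg (by norm_num [Real.holderConjugate_iff])
        (.of_forall fun _ => abs_nonneg _) (.of_forall fun _ => abs_nonneg _) ?_ ?_
      · simpa [Pi.abs_def] using hu.abs
      · simpa [Pi.abs_def] using hg.abs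

/-- The Laplacian of a function of `‖ξ - w‖² + s` on the complex plane. -/
theorem laplacian_comp_norm_sub_sq_add {H H₁ H₂ : ℝ → ℝ} (h₁ : ∀ t, 0 < t → HasDerivAt H (H₁ t) t)
    (h₂ : ∀ t, 0 < t → HasDerivAt H₁ (H₂ t) t) (w : ℂ) {s : ℝ} (hs : 0 < s) (ξ : ℂ) :
    (Δ fun ξ : ℂ => H (‖ξ - w‖ ^ 2 + s)) ξ =
      4 * (‖ξ - w‖ ^ 2 * H₂ (‖ξ - w‖ ^ 2 + s) + H₁ (‖ξ - w‖ ^ 2 + s)) := by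
  have hq : ∀ ξ : ℂ, HasFDerivAt (fun ξ : ℂ => ‖ξ - w‖ ^ 2 + s) (2 • innerSL ℝ (ξ - w)) ξ := by
    intro ξ
    simpa using (((hasFDerivAt_id (𝕜 := ℝ) ξ).sub_const w).norm_sq).add_const s
  have hpos : ∀ ξ : ℂ, 0 < ‖ξ - w‖ ^ 2 + s := fun ξ => by positivity
  have hd : fderiv ℝ (fun ξ : ℂ => H (‖ξ - w‖ ^ 2 + s)) =
      fun ξ => H₁ (‖ξ - w‖ ^ 2 + s) • (2 • innerSL ℝ (ξ - w)) :=
    funext fun ξ => ((h₁ _ (hpos ξ)).comp_hasFDerivAt ξ (hq ξ)).fderiv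
  have hlin : HasFDerivAt (fun ξ : ℂ => (2 • innerSL ℝ (ξ - w) : ℂ →L[ℝ] ℝ))
      (2 • innerSL ℝ : ℂ →L[ℝ] ℂ →L[ℝ] ℝ) ξ := by
    exact (2 • innerSL ℝ : ℂ →L[ℝ] ℂ →L[ℝ] ℝ).hasFDerivAt.comp ξ
      ((hasFDerivAt_id (𝕜 := ℝ) ξ).sub_const w)
  have hdd : fderiv ℝ (fun ξ : ℂ => H₁ (‖ξ - w‖ ^ 2 + s) • (2 • innerSL ℝ (ξ - w))) ξ = _ :=
    (((h₂ _ (hpos ξ)).comp_hasFDerivAt ξ (hq ξ)).smul hlin).fderiv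
  have hn : ‖ξ - w‖ ^ 2 = (ξ - w).re ^ 2 + (ξ - w).im ^ 2 := by
    rw [← Complex.normSq_eq_norm_sq, Complex.normSq_apply]
    ring
  rw [InnerProductSpace.laplacian_eq_iteratedFDeriv_complexPlane]
  simp only [iteratedFDeriv_two_apply, hd, Matrix.cons_val_zero, Matrix.cons_val_one]
  rw [hdd]
  have h1 : innerSL ℝ (1 : ℂ) 1 = 1 := by simp [innerSL_apply_apply]
  have hI : innerSL ℝ Complex.I Complex.I = 1 := by simp [innerSL_apply_apply]
  simp [Complex.inner, h1, hI]
  rw [hn]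
  simp
  ring

/-- The kernel `(π (1 + ‖x‖²)²)⁻¹` has unit mass on the plane. -/
theorem integral_inv_pi_mul_one_add_norm_sq_sq :
    ∫ x : ℂ, (Real.pi * (1 + ‖x‖ ^ 2) ^ 2)⁻¹ = 1 := by
  have hd : ∀ y ∈ Ici (0 : ℝ), HasDerivAt (fun y : ℝ => -(2 * Real.pi * (1 + y ^ 2))⁻¹)
      (y * (Real.pi * (1 + y ^ 2) ^ 2)⁻¹) y := by
    intro y _
    have hp := Real.pi_pos
    refine ((((hasDerivAt_pow 2 y).const_add 1).const_mul (2 * Real.pi)).fun_inv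
      (by positivity)).fun_neg.congr_deriv ?_
    field_simp
    simp
  have hl : Tendsto (fun y : ℝ => -(2 * Real.pi * (1 + y ^ 2))⁻¹) atTop (𝓝 (-0)) := by
    refine (tendsto_inv_atTop_zero.comp ?_).neg
    exact (tendsto_atTop_add_const_left _ 1 (tendsto_pow_atTop two_ne_zero)).const_mul_atTop
      Real.two_pi_pos
  have := integral_Ioi_of_hasDerivAt_of_nonneg' hd (fun y hy => by
    have : (0 : ℝ) < y := hy
    have hp := Real.pi_pos
    positivity) hl
  rw [integral_fun_norm_addHaar volume fun y : ℝ => (Real.pi * (1 + y ^ 2) ^ 2)⁻¹,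
    Complex.finrank_real_complex]
  simp only [Nat.add_one_sub_one, pow_one, smul_eq_mul, this]
  have hp := Real.pi_pos
  simp [Measure.real]

/-- The kernel `s / (π (‖ξ - w‖² + s)²)`, `s = c⁻²`, is a peak function as `c → ∞`. -/
theorem tendsto_integral_peak {g : ℂ → ℝ} (hg : Integrable g) {w : ℂ}
    (hw : ContinuousAt g w) :
    Tendsto (fun c : ℝ => ∫ ξ, (c ^ 2)⁻¹ / (Real.pi * (‖ξ - w‖ ^ 2 + (c ^ 2)⁻¹) ^ 2) * g ξ)
      atTop (𝓝 (g w)) := by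
  have hp := Real.pi_pos
  have h := tendsto_integral_comp_smul_smul_of_integrable' (μ := (volume : Measure ℂ))
    (φ := fun x : ℂ => (Real.pi * (1 + ‖x‖ ^ 2) ^ 2)⁻¹) (fun x => by positivity)
    integral_inv_pi_mul_one_add_norm_sq_sq ?_ hg hw
  · refine h.congr' ?_
    filter_upwards [eventually_gt_atTop 0] with c hc
    refine integral_congr_ae (.of_forall fun ξ => ?_)
    simp only [Complex.finrank_real_complex, norm_smul, smul_eq_mul, Real.norm_eq_abs, abs_of_pos hc,
      norm_sub_rev w ξ]
    congr 1
    field_simp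
    rw [add_comm]
  · rw [Complex.finrank_real_complex]
    have hl : Tendsto (fun x : ℂ => (Real.pi * ‖x‖ ^ 2)⁻¹) (Bornology.cobounded ℂ) (𝓝 0) :=
      tendsto_inv_atTop_zero.comp (((tendsto_pow_atTop two_ne_zero).comp
        tendsto_norm_cobounded_atTop).const_mul_atTop hp)
    refine squeeze_zero (fun x => by positivity) (fun x => ?_) hl
    rcases eq_or_ne x 0 with rfl | hx
    · simp
    have : 0 < ‖x‖ := norm_pos_iff.2 hx
    rw [← div_eq_mul_inv, div_le_iff₀ (by positivity), inv_mul_eq_div, le_div_iff₀ (by positivity)]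
    have h2 : 0 < ‖x‖ ^ 2 := by positivity
    nlinarith [sq_nonneg (‖x‖ ^ 2), mul_pos hp h2]

theorem continuous_peak {w : ℂ} {s : ℝ} (hs : 0 < s) :
    Continuous fun ξ : ℂ => s / (Real.pi * (‖ξ - w‖ ^ 2 + s) ^ 2) := by
  have hp := Real.pi_pos
  exact continuous_const.div (by fun_prop) fun ξ => by positivity

theorem abs_peak_le {w ξ : ℂ} {s : ℝ} (hs : 0 < s) :
    |s / (Real.pi * (‖ξ - w‖ ^ 2 + s) ^ 2)| ≤ (Real.pi * s)⁻¹ := by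
  have hp := Real.pi_pos
  rw [abs_of_nonneg (by positivity), div_le_iff₀ (by positivity), inv_mul_eq_div,
    le_div_iff₀ (by positivity)]
  nlinarith [sq_nonneg (‖ξ - w‖ ^ 2), mul_nonneg hs.le (sq_nonneg ‖ξ - w‖),
    mul_nonneg hp.le (mul_nonneg hs.le (sq_nonneg ‖ξ - w‖)),
    mul_nonneg hp.le (sq_nonneg (‖ξ - w‖^2))]

/-- The logarithm, divided by `4π` and cut off smoothly between `b / 2` and `b`. -/
noncomputable def cutoffLog (b t : ℝ) : ℝ :=
  Real.log t / (4 * Real.pi) * Real.smoothTransition ((b - t) / (b / 2))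

theorem cutoffLog_of_le {b t : ℝ} (hb : 0 < b) (ht : t ≤ b / 2) :
    cutoffLog b t = Real.log t / (4 * Real.pi) := by
  rw [cutoffLog, Real.smoothTransition.one_of_one_le, mul_one]
  rw [le_div_iff₀ (by positivity)]
  linarith

theorem cutoffLog_of_ge {b t : ℝ} (hb : 0 < b) (ht : b ≤ t) : cutoffLog b t = 0 := by
  rw [cutoffLog, Real.smoothTransition.zero_of_nonpos, mul_zero]
  exact div_nonpos_of_nonpos_of_nonneg (by linarith) (by positivity)

theorem abs_cutoffLog_le (b t : ℝ) : |cutoffLog b t| ≤ |Real.log t| / (4 * Real.pi) := by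
  have hp := Real.pi_pos
  rw [cutoffLog, abs_mul, abs_div, abs_of_pos (show 0 < 4 * Real.pi by positivity),
    abs_of_nonneg (Real.smoothTransition.nonneg _)]
  exact mul_le_of_le_one_right (by positivity) (Real.smoothTransition.le_one _)

theorem contDiffOn_cutoffLog (b : ℝ) : ContDiffOn ℝ ∞ (cutoffLog b) (Ioi 0) := by
  intro t ht
  have ht' : t ≠ 0 := (mem_Ioi.1 ht).ne'
  refine ContDiffAt.contDiffWithinAt (((Real.contDiffAt_log.2 ht').div_const _).mul ?_)
  exact Real.smoothTransition.contDiffAt.comp t ((contDiffAt_const.sub contDiffAt_id).div_const _)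

theorem contDiffOn_deriv_cutoffLog (b : ℝ) : ContDiffOn ℝ ∞ (deriv (cutoffLog b)) (Ioi 0) :=
  ((contDiffOn_infty_iff_deriv_of_isOpen isOpen_Ioi).1 (contDiffOn_cutoffLog b)).2

theorem hasDerivAt_cutoffLog (b : ℝ) {t : ℝ} (ht : 0 < t) :
    HasDerivAt (cutoffLog b) (deriv (cutoffLog b) t) t :=
  (((contDiffOn_cutoffLog b).contDiffAt (Ioi_mem_nhds ht)).differentiableAt (by simp)).hasDerivAt

theorem hasDerivAt_deriv_cutoffLog (b : ℝ) {t : ℝ} (ht : 0 < t) :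
    HasDerivAt (deriv (cutoffLog b)) (deriv (deriv (cutoffLog b)) t) t :=
  (((contDiffOn_deriv_cutoffLog b).contDiffAt (Ioi_mem_nhds ht)).differentiableAt
    (by simp)).hasDerivAt

theorem deriv_cutoffLog_of_lt {b t : ℝ} (hb : 0 < b) (ht0 : 0 < t) (ht : t < b / 2) :
    deriv (cutoffLog b) t = (4 * Real.pi * t)⁻¹ ∧
      deriv (deriv (cutoffLog b)) t = -(4 * Real.pi * t ^ 2)⁻¹ := by
  have hp := Real.pi_pos
  have h1 : ∀ t, 0 < t → t < b / 2 → deriv (cutoffLog b) t = (4 * Real.pi * t)⁻¹ := by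
    intro t ht0 ht
    have : cutoffLog b =ᶠ[𝓝 t] fun t => Real.log t / (4 * Real.pi) := by
      filter_upwards [gt_mem_nhds ht] with x hx using cutoffLog_of_le hb hx.le
    rw [this.deriv_eq, ((Real.hasDerivAt_log ht0.ne').div_const _).deriv]
    field_simp
  refine ⟨h1 t ht0 ht, ?_⟩
  have : deriv (cutoffLog b) =ᶠ[𝓝 t] fun t => (4 * Real.pi * t)⁻¹ := by
    filter_upwards [gt_mem_nhds ht, lt_mem_nhds ht0] with x hx hx0 using h1 x hx0 hx
  rw [this.deriv_eq, (((hasDerivAt_id' t).const_mul (4 * Real.pi)).fun_inv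
    (by positivity)).deriv]
  field_simp

theorem deriv_cutoffLog_of_gt {b t : ℝ} (hb : 0 < b) (ht : b < t) :
    deriv (cutoffLog b) t = 0 ∧ deriv (deriv (cutoffLog b)) t = 0 := by
  have h1 : ∀ t, b < t → deriv (cutoffLog b) t = 0 := by
    intro t ht
    have : cutoffLog b =ᶠ[𝓝 t] fun _ => 0 := by
      filter_upwards [lt_mem_nhds ht] with x hx using cutoffLog_of_ge hb hx.le
    rw [this.deriv_eq, deriv_const]
  refine ⟨h1 t ht, ?_⟩
  have : deriv (cutoffLog b) =ᶠ[𝓝 t] fun _ => 0 := by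
    filter_upwards [lt_mem_nhds ht] with x hx using h1 x hx
  rw [this.deriv_eq, deriv_const]

/-- Up to an error bounded uniformly in `s`, the Laplacian of the regularized cut-off logarithm is
the peak kernel. -/
theorem exists_bound_laplacian_cutoffLog_sub_peak {b : ℝ} (hb : 0 < b) :
    ∃ M : ℝ, ∀ s t : ℝ, 0 < s → s ≤ 1 → 0 ≤ t →
      |4 * (t * deriv (deriv (cutoffLog b)) (t + s) + deriv (cutoffLog b) (t + s)) -
        s / (Real.pi * (t + s) ^ 2)| ≤ M := by
  have hp := Real.pi_pos
  have hsub : Icc (b / 2) b ⊆ Ioi 0 := fun x hx => (half_pos hb).trans_le hx.1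
  have hc1 : ContinuousOn (deriv (cutoffLog b)) (Icc (b / 2) b) :=
    (contDiffOn_deriv_cutoffLog b).continuousOn.mono hsub
  have hc2 : ContinuousOn (deriv (deriv (cutoffLog b))) (Icc (b / 2) b) :=
    ((contDiffOn_infty_iff_deriv_of_isOpen isOpen_Ioi).1
      (contDiffOn_deriv_cutoffLog b)).2.continuousOn.mono hsub
  obtain ⟨C₁, hC₁⟩ := isCompact_Icc.exists_bound_of_continuousOn hc1
  obtain ⟨C₂, hC₂⟩ := isCompact_Icc.exists_bound_of_continuousOn hc2
  have hmid : b / 2 ∈ Icc (b / 2) b := ⟨le_rfl, by linarith⟩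
  have hC₁0 : 0 ≤ C₁ := (norm_nonneg _).trans (hC₁ _ hmid)
  have hC₂0 : 0 ≤ C₂ := (norm_nonneg _).trans (hC₂ _ hmid)
  refine ⟨4 * (b * C₂ + C₁) + (Real.pi * (b / 2) ^ 2)⁻¹, fun s t hs hs1 ht => ?_⟩
  have hτ : 0 < t + s := by positivity
  rcases lt_or_ge (t + s) (b / 2) with h | h
  · obtain ⟨e1, e2⟩ := deriv_cutoffLog_of_lt hb hτ h
    have : 4 * (t * deriv (deriv (cutoffLog b)) (t + s) + deriv (cutoffLog b) (t + s)) -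
        s / (Real.pi * (t + s) ^ 2) = 0 := by
      rw [e1, e2]
      field_simp
      ring
    rw [this, abs_zero]
    positivity
  · have hpk : |s / (Real.pi * (t + s) ^ 2)| ≤ (Real.pi * (b / 2) ^ 2)⁻¹ := by
      rw [abs_of_nonneg (by positivity), div_eq_mul_inv]
      have h3 : (Real.pi * (t + s) ^ 2)⁻¹ ≤ (Real.pi * (b / 2) ^ 2)⁻¹ := by gcongr
      exact (mul_le_of_le_one_left (by positivity) hs1).trans h3
    refine (abs_sub _ _).trans (add_le_add ?_ hpk)
    rw [abs_mul, abs_of_pos (by norm_num : (0 : ℝ) < 4)]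
    refine mul_le_mul_of_nonneg_left ?_ (by norm_num)
    rcases lt_or_ge b (t + s) with h' | h'
    · obtain ⟨e1, e2⟩ := deriv_cutoffLog_of_gt hb h'
      rw [e1, e2, mul_zero, add_zero, abs_zero]
      positivity
    · refine (abs_add_le _ _).trans (add_le_add ?_ (hC₁ _ ⟨h, h'⟩))
      rw [abs_mul, abs_of_nonneg ht]
      exact mul_le_mul (by linarith) (hC₂ _ ⟨h, h'⟩) (abs_nonneg _) hb.le

/-- The logarithm of the norm is locally square integrable on the plane. -/
theorem memLp_two_log_norm (r : ℝ) :
    MemLp (fun x : ℂ => Real.log ‖x‖) 2 (volume.restrict (Metric.ball 0 r)) := by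
  have hm : Measurable fun x : ℂ => Real.log ‖x‖ := by fun_prop
  rw [memLp_two_iff_integrable_sq hm.aestronglyMeasurable]
  have h : IntegrableOn (fun y : ℝ => 4 * (√y * Real.log √y) ^ 2) (Ioo 0 r) :=
    (Continuous.integrableOn_Icc (by
      have := Real.continuous_mul_log.comp Real.continuous_sqrt
      simp only [Function.comp_def] at this
      fun_prop)).mono_set Ioo_subset_Icc_self
  refine (integrableOn_fun_norm_addHaar volume (f := fun y : ℝ => Real.log y ^ 2)).2 ?_
  refine h.congr_fun (fun y hy => ?_) measurableSet_Ioo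
  simp only [Complex.finrank_real_complex, Real.log_sqrt hy.1.le, mul_pow, Real.sq_sqrt hy.1.le,
    smul_eq_mul]
  ring

namespace IsGreenFunction

variable {D : Set ℂ} {z : ℂ} {g : ℂ → ℝ}

theorem memLp_sdiff_ball (hg : IsGreenFunction D z g) (hD : IsOpen D)
    (hb : Bornology.IsBounded D) {r : ℝ} (hr : 0 < r) (p : ENNReal) :
    MemLp g p (volume.restrict (D \ Metric.ball z r)) := by
  refine memLp_restrict_of_continuousOn_isCompact (hb.subset sdiff_subset)
    (hD.measurableSet.diff Metric.isOpen_ball.measurableSet)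
    (hb.isCompact_closure.diff Metric.isOpen_ball) (sdiff_subset_sdiff_left subset_closure)
    (hg.continuousOn.mono (sdiff_subset_sdiff_right ?_))
  exact singleton_subset_iff.2 (Metric.mem_ball_self hr)

theorem integrableOn (hg : IsGreenFunction D z g) (hD : IsOpen D)
    (hb : Bornology.IsBounded D) (hz : z ∈ D) : IntegrableOn g D := by
  obtain ⟨r, hr, hrD⟩ := Metric.nhds_basis_closedBall.mem_iff.1 (hD.mem_nhds hz)
  have h1 : IntegrableOn g (Metric.closedBall z r) :=
    hg.locallyIntegrable.integrableOn_compact_subset hrD (isCompact_closedBall z r)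
  have h2 : IntegrableOn g (D \ Metric.ball z r) :=
    memLp_one_iff_integrable.1 (hg.memLp_sdiff_ball hD hb hr 1)
  refine (h1.union h2).mono_set fun x hx => ?_
  by_cases hxr : x ∈ Metric.ball z r
  · exact Or.inl (Metric.ball_subset_closedBall hxr)
  · exact Or.inr ⟨hx, hxr⟩

/-- Testing the distributional equation with the regularized, cut-off logarithm. -/
theorem integral_mul_laplacian_cutoffLog (hg : IsGreenFunction D z g) {w : ℂ} {r s : ℝ}
    (hr : 0 < r) (hs : 0 < s) (hD : Metric.closedBall w r ⊆ D) :
    ∫ ξ in D, g ξ * (4 * (‖ξ - w‖ ^ 2 * deriv (deriv (cutoffLog (r ^ 2))) (‖ξ - w‖ ^ 2 + s) +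
      deriv (cutoffLog (r ^ 2)) (‖ξ - w‖ ^ 2 + s))) = cutoffLog (r ^ 2) (‖z - w‖ ^ 2 + s) := by
  have hsupp : Function.support (fun ξ : ℂ => cutoffLog (r ^ 2) (‖ξ - w‖ ^ 2 + s)) ⊆
      Metric.closedBall w r := by
    intro ξ hξ
    by_contra h
    rw [Metric.mem_closedBall, dist_eq_norm, not_le] at h
    exact hξ (cutoffLog_of_ge (by positivity) (by nlinarith))
  have ht := closure_minimal hsupp Metric.isClosed_closedBall
  have hsm : ContDiff ℝ ∞ fun ξ : ℂ => cutoffLog (r ^ 2) (‖ξ - w‖ ^ 2 + s) := by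
    refine (contDiffOn_cutoffLog (r ^ 2)).comp_contDiff
      (((contDiff_id.sub contDiff_const).norm_sq ℝ).add contDiff_const) fun ξ => ?_
    rw [mem_Ioi]
    positivity
  rw [← hg.laplacian_eq _ hsm ((isCompact_closedBall w r).of_isClosed_subset
    (isClosed_tsupport _) ht) (ht.trans hD)]
  refine integral_congr_ae (.of_forall fun ξ => ?_)
  simp only
  rw [laplacian_comp_norm_sub_sq_add (fun t ht => hasDerivAt_cutoffLog _ ht)
    (fun t ht => hasDerivAt_deriv_cutoffLog _ ht) w hs ξ]

/-- The Green function has at most a logarithmic singularity at its pole. -/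
theorem exists_abs_le_log_add (hg : IsGreenFunction D z g) (hDo : IsOpen D)
    (hb : Bornology.IsBounded D) {r : ℝ} (hr : 0 < r) (hD : Metric.closedBall z (2 * r) ⊆ D) :
    ∃ C, ∀ w ∈ Metric.ball z r, w ≠ z → |g w| ≤ |Real.log ‖w - z‖| / (2 * Real.pi) + C := by
  have hp := Real.pi_pos
  obtain ⟨M, hM⟩ := exists_bound_laplacian_cutoffLog_sub_peak (b := r ^ 2) (by positivity)
  have hgi : IntegrableOn g D := hg.integrableOn hDo hb
    (hD (Metric.mem_closedBall_self (by positivity)))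
  refine ⟨M * ∫ ξ in D, |g ξ|, fun w hw hwz => ?_⟩
  have hwD : Metric.closedBall w r ⊆ D := by
    refine (Metric.closedBall_subset_closedBall' ?_).trans hD
    linarith [Metric.mem_ball.1 hw]
  have hwD' : w ∈ D := hwD (Metric.mem_closedBall_self hr.le)
  have hcont : ContinuousAt (D.indicator g) w := by
    have hnhds : D \ {z} ∈ 𝓝 w := (hDo.sdiff isClosed_singleton).mem_nhds ⟨hwD', hwz⟩
    have h1 : ContinuousAt g w := (hg.continuousOn.mono
      (sdiff_subset_sdiff_left subset_closure)).continuousAt hnhds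
    refine h1.congr ?_
    filter_upwards [hDo.mem_nhds hwD'] with x hx using (indicator_of_mem hx g).symm
  have hlim := (tendsto_integral_peak ((integrable_indicator_iff hDo.measurableSet).2 hgi)
    hcont).abs
  rw [indicator_of_mem hwD'] at hlim
  have hnz : 0 < ‖z - w‖ := norm_pos_iff.2 (sub_ne_zero.2 hwz.symm)
  have hcl : Tendsto (fun c : ℝ => |cutoffLog (r ^ 2) (‖z - w‖ ^ 2 + (c ^ 2)⁻¹)| +
      M * ∫ ξ in D, |g ξ|) atTop
      (𝓝 (|cutoffLog (r ^ 2) (‖z - w‖ ^ 2)| + M * ∫ ξ in D, |g ξ|)) := by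
    have h1 : Tendsto (fun c : ℝ => ‖z - w‖ ^ 2 + (c ^ 2)⁻¹) atTop (𝓝 (‖z - w‖ ^ 2)) := by
      simpa using (tendsto_inv_atTop_zero.comp
        (tendsto_pow_atTop (α := ℝ) two_ne_zero)).const_add (‖z - w‖ ^ 2)
    exact ((((hasDerivAt_cutoffLog (r ^ 2) (pow_pos hnz 2)).continuousAt.tendsto.comp
      h1).abs).add_const _)
  have hfin : |g w| ≤ |cutoffLog (r ^ 2) (‖z - w‖ ^ 2)| + M * ∫ ξ in D, |g ξ| := by
    refine le_of_tendsto_of_tendsto hlim hcl ?_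
    filter_upwards [eventually_ge_atTop 1] with c hc
    have hs : 0 < (c ^ 2)⁻¹ := by positivity
    have hs1 : (c ^ 2)⁻¹ ≤ 1 := inv_le_one_of_one_le₀ (one_le_pow₀ hc)
    set s := (c ^ 2)⁻¹
    set P : ℂ → ℝ := fun ξ => s / (Real.pi * (‖ξ - w‖ ^ 2 + s) ^ 2) with hP
    set L : ℂ → ℝ := fun ξ => 4 * (‖ξ - w‖ ^ 2 * deriv (deriv (cutoffLog (r ^ 2)))
      (‖ξ - w‖ ^ 2 + s) + deriv (cutoffLog (r ^ 2)) (‖ξ - w‖ ^ 2 + s)) with hL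
    have hb : ∀ ξ, |P ξ - L ξ| ≤ M := fun ξ => by
      rw [abs_sub_comm]
      exact hM s (‖ξ - w‖ ^ 2) hs hs1 (by positivity)
    have hPi : Integrable (fun ξ => P ξ * g ξ) (volume.restrict D) :=
      hgi.bdd_mul (continuous_peak hs).aestronglyMeasurable (.of_forall fun ξ => abs_peak_le hs)
    have hLm : Measurable L := by
      have h1 : Measurable fun ξ : ℂ => ‖ξ - w‖ ^ 2 := by fun_prop
      have h2 : Measurable fun ξ : ℂ => ‖ξ - w‖ ^ 2 + s := by fun_prop
      exact ((h1.mul ((measurable_deriv _).comp h2)).add ((measurable_deriv _).comp h2)).const_mul 4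
    have hRi : Integrable (fun ξ => (P ξ - L ξ) * g ξ) (volume.restrict D) :=
      hgi.bdd_mul ((continuous_peak hs).measurable.sub hLm).aestronglyMeasurable (.of_forall hb)
    have hLi : ∫ ξ in D, (P ξ * g ξ - (P ξ - L ξ) * g ξ) =
        cutoffLog (r ^ 2) (‖z - w‖ ^ 2 + s) := by
      rw [← hg.integral_mul_laplacian_cutoffLog hr hs hwD]
      refine integral_congr_ae (.of_forall fun ξ => ?_)
      simp only [hL]
      ring
    have hind : ∫ ξ, P ξ * D.indicator g ξ = ∫ ξ in D, P ξ * g ξ := by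
      rw [← integral_indicator hDo.measurableSet]
      simp only [indicator_mul_right]
    rw [hind, ← sub_add_cancel (∫ ξ in D, P ξ * g ξ) (∫ ξ in D, (P ξ - L ξ) * g ξ),
      ← integral_sub hPi hRi, hLi]
    refine (abs_add_le _ _).trans (add_le_add_right ?_ _)
    rw [← integral_const_mul]
    refine abs_integral_le_integral_abs.trans (integral_mono hRi.abs (hgi.abs.const_mul M) ?_)
    intro ξ
    simp only [abs_mul]
    exact mul_le_mul_of_nonneg_right (hb ξ) (abs_nonneg _)
  refine hfin.trans (add_le_add_left ((abs_cutoffLog_le _ _).trans_eq ?_) _)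
  rw [Real.log_pow, norm_sub_rev, abs_mul]
  norm_num
  field_simp
  ring

theorem memLp_two (hg : IsGreenFunction D z g) (hD : IsOpen D) (hb : Bornology.IsBounded D)
    (hz : z ∈ D) : MemLp g 2 (volume.restrict D) := by
  obtain ⟨R, hR, hRD⟩ := Metric.nhds_basis_closedBall.mem_iff.1 (hD.mem_nhds hz)
  have hr : 0 < R / 2 := by positivity
  obtain ⟨C, hC⟩ := hg.exists_abs_le_log_add hD hb hr (by rwa [mul_div_cancel₀ _ two_ne_zero])
  have hball : Metric.ball z (R / 2) ⊆ D :=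
    (Metric.ball_subset_closedBall.trans (Metric.closedBall_subset_closedBall (by linarith))).trans
      hRD
  have hlog : MemLp (fun w : ℂ => Real.log ‖w - z‖) 2
      (volume.restrict (Metric.ball z (R / 2))) := by
    have hmp : MeasurePreserving (fun w : ℂ => w - z) (volume.restrict (Metric.ball z (R / 2)))
        (volume.restrict (Metric.ball 0 (R / 2))) := by
      convert (measurePreserving_sub_right (volume : Measure ℂ) z).restrict_preimage
        (Metric.isOpen_ball (x := (0 : ℂ)) (ε := R / 2)).measurableSet using 2
      ext w
      simp [dist_eq_norm]
    exact (memLp_two_log_norm (R / 2)).comp_measurePreserving hmp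
  have : IsFiniteMeasure (volume.restrict (Metric.ball z (R / 2))) :=
    isFiniteMeasure_restrict.2 measure_ball_lt_top.ne
  have hin : MemLp g 2 (volume.restrict (Metric.ball z (R / 2))) := by
    have hdom : MemLp (fun w : ℂ => |Real.log ‖w - z‖| * (2 * Real.pi)⁻¹ + C) 2
        (volume.restrict (Metric.ball z (R / 2))) :=
      (hlog.abs.mul_const _).add (memLp_const C)
    refine hdom.mono' ((hg.integrableOn hD hb hz).mono_set hball).aestronglyMeasurable ?_
    have hne : ∀ᵐ w : ℂ, w ≠ z := by simp [ae_iff]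
    filter_upwards [ae_restrict_of_ae hne, ae_restrict_mem Metric.isOpen_ball.measurableSet]
      with w hwz hw
    exact hC w hw hwz
  have hout := hg.memLp_sdiff_ball hD hb hr 2
  rw [memLp_two_iff_integrable_sq (hg.integrableOn hD hb hz).aestronglyMeasurable]
  have hun : IntegrableOn (fun x => g x ^ 2)
      (Metric.ball z (R / 2) ∪ (D \ Metric.ball z (R / 2))) :=
    IntegrableOn.union ((memLp_two_iff_integrable_sq hin.1).1 hin)
      ((memLp_two_iff_integrable_sq hout.1).1 hout)
  rwa [union_sdiff_cancel hball] at hun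

end IsGreenFunction

theorem mainTheorem7 (D : Set ℂ) (hD : IsBoundedC1Domain D)
    (u : ℂ → ℝ) (hu : IsSmoothOnClosure D u) (hu_nonneg : ∀ ξ ∈ D, 0 ≤ u ξ)
    (f : frontier D → ℝ) (hf : Measurable f) (hf_bdd : ∃ M : ℝ, ∀ ζ, |f ζ| ≤ M)
    (z : ℂ) (hz : z ∈ D) (g : ℂ → ℝ) (hg : IsGreenFunction D z g) :
    MemLp u 2 (volume.restrict D) ∧ MemLp g 2 (volume.restrict D) ∧
      IntegrableOn (fun ξ => u ξ * dirichletSolution D f ξ * g ξ) D ∧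
      |firstOrderTerm D u f g| ≤ l2Norm D u * l2Norm D g * boundarySupNorm D f := by
  have hu2 : MemLp u 2 (volume.restrict D) := by
    obtain ⟨U, -, hDU, hu⟩ := hu
    exact memLp_restrict_of_continuousOn_isCompact hD.isBounded hD.isOpen.measurableSet
      hD.isBounded.isCompact_closure subset_closure (hu.continuousOn.mono hDU)
  have hg2 := hg.memLp_two hD.isOpen hD.isBounded hz
  have hfM : ∀ ζ, |f ζ| ≤ boundarySupNorm D f := fun ζ =>
    le_ciSup (f := fun ζ => |f ζ|) (hf_bdd.imp fun M hM => forall_mem_range.2 hM) ζ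
  obtain ⟨hi, hle⟩ := integrable_and_abs_integral_mul_mul_le hu2 hg2
    (aestronglyMeasurable_dirichletSolution hD.isOpen hD.isBounded hfM)
    (ae_restrict_of_forall_mem hD.isOpen.measurableSet fun ξ hξ =>
      abs_dirichletSolution_le hD.isOpen hD.isBounded hfM hξ)
  exact ⟨hu2, hg2, hi, hle⟩
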